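/- Let $\mathcal H$ be a separable complex Hilbert space, $\Lambda$ a finite or countable set, and $\mathcal K$ a Hilbert space with orthonormal basis $(|i\rangle)_{i\in\Lambda}$. Let $B^i_j\in\mathcal B(\mathcal H)$ $(i,j\in\Lambda)$ satisfy $\sum_i {B^i_j}^*B^i_j=I$ strongly for each $j$, put $M^i_j=B^i_j\otimes|i\rangle\langle j|$ and $\mathcal M(\rho)=\sum_i\sum_j M^i_j\rho {M^i_j}^*$. Let $\rho^{(0)}=\sum_i\rho^{(0)}_i\otimes|i\rangle\langle i|$ be a density matrix ($\rho_i^{(0)}\ge 0$ trace class, $\sum_i\mathrm{Tr}\,\rho^{(0)}_i=1$), and write $\rho^{(n)}=\mathcal M^n(\rho^{(0)})=\sum_i\rho^{(n)}_i\otimes|i\rangle\langle i|$. Let $\mathcal B$ be the von Neumann algebra of block-diagonal operators on $\mathcal H\otimes\mathcal K$, i.e. the weak closure of $\{\sum_i a(i)\otimes|i\rangle\langle i| : \sum_i\|a(i)\|<\infty\}$. For $x,y\in\mathcal B$ put $$\mathcal E^{(n)}(x\otimes y)=\sum_{j:\rho^{(n)}_j\ne0}\sum_i\frac{\mathrm{Tr}\big((\rho^{(n)}_j\otimes|j\rangle\langle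 j|)\,x\big)}{\mathrm{Tr}(\rho^{(n)}_j)}\,{M^i_j}^*\,y\,M^i_j ,$$ let $\bar b(n)$ be the strong limit, as $k\to\infty$, of $\mathcal E^{(n)}(I\otimes\mathcal E^{(n+1)}(I\otimes\cdots\mathcal E^{(n+k)}(I\otimes I)))$, and on the infinite tensor product $\mathcal A=\mathcal B\otimes\mathcal B\otimes\cdots$ let $E_{0]}$ be the positive linear map with $$E_{0]}(a_0\otimes a_1\otimes\cdots)=\lim_{n\to\infty}\mathcal E^{(0)}(a_0\otimes\mathcal E^{(1)}(a_1\otimes\cdots\mathcal E^{(n)}(a_n\otimes\bar b(n+1))))\quad\text{(strong limit)}.$$ For a projection $p\in\mathcal B$ and $n_0\ge 0$ let $p_{[n_0}=I\otimes\cdots\otimes I\otimes p\otimes p\otimes\cdots$, the first $p$ standing at place $n_0$ (places are numbered from $0$). The pair $(\rho^{(0)},(\mathcal E^{(n)})_{n\ge0})$ is the quantum Markov chain (QMC) associated with the walk. It is called reducible if there are a projection $p\in\mathcal B$, $p\ne0,I$, and $n_0\ge0$ with $E_{0]}(p_{[n_0}\,a\,p_{[n_0})=E_{0]}(a)$ for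 all $a\in\mathcal A$; such a $p_{[n_0}$ is called a reducing projection. Here the condition is required for all finite linear combinations $a$ of product elements $a_0\otimes a_1\otimes\cdots$ (in the sense that one side exists if and only if the other does, and then they agree), and also for all $a$ in the von Neumann algebra generated by the factors, in every realisation of the tensor product on a Hilbert space by commuting copies of $\mathcal B$ and for every positive linear map $E_{0]}$ on it that is given by the formula above on the product elements. **Theorem.** Suppose that $h$ is an orthogonal projection on $\mathcal H$, $h\neq0,I$, such that $$hB_\pi=B_\pi,\qquad B_\pi=B^{i_l}_{i_{l-1}}\cdots B^{i_1}_{i_0},$$ for all $i,j\in\Lambda$ and every path $\pi=(i=i_0,i_1,\dots,i_l=j)$, $l\ge1$, in $\Lambda$. Then $(\rho^{(0)},(\mathcal E^{(n)})_{n\ge0})$ is indeed a QMC (the limits $\bar b(n)$ exist, the formula for $E_{0]}$ is consistent at $a_0\otimes\cdots\otimes a_n\otimes I\otimes I\otimes\cdots$, and $\mathrm{Tr}(\rho^{(0)}E_{0]}(I))=1$), and it is reducible, with reducing projection $p_{[1}$, where $p=h\otimes I_{\mathcal K}$. -/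

import Mathlib

open Filter Topology

universe u v w

noncomputable section

namespace OQRW


/-- Bounded operators on a complex Hilbert space. -/
abbrev Op (G : Type*) [NormedAddCommGroup G] [InnerProductSpace ℂ G] := G →L[ℂ] G

section Operators

variable {G : Type u} [NormedAddCommGroup G] [InnerProductSpace ℂ G]

/-- Convergence of a sequence of operators in the strong operator topology. -/
def StrongTendsto (f : ℕ → Op G) (T : Op G) : Prop :=
  ∀ ξ : G, Tendsto (fun n => f n ξ) atTop (𝓝 (T ξ))

open Classical in
/-- The limit of a sequence in the strong operator topology (`0` if there is none). -/
def strongLim (f : ℕ → Op G) : Op G :=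
  if h : ∃ T, StrongTendsto f T then h.choose else 0

open Classical in
/-- The sum of a family in the strong operator topology (`0` if it does not converge). -/
def strongSum {ι : Type*} (f : ι → Op G) : Op G :=
  if h : ∃ T : Op G, ∀ ξ, HasSum (fun i => f i ξ) (T ξ) then h.choose else 0

variable [CompleteSpace G]

variable (G) in
/-- The index set of a fixed orthonormal (Hilbert) basis of `G`. -/
def basisIndex : Set G := (exists_hilbertBasis ℂ G).choose

variable (G) in
/-- A fixed orthonormal (Hilbert) basis of `G`. -/
def stdBasis : HilbertBasis (basisIndex G) ℂ G :=
  (exists_hilbertBasis ℂ G).choose_spec.choose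

/-- The trace `∑ₖ ⟨eₖ, T eₖ⟩`; for trace class `T` the series converges absolutely and its sum does
not depend on the orthonormal basis. -/
def opTrace (T : Op G) : ℂ := ∑' k, inner ℂ (stdBasis G k) (T (stdBasis G k))

/-- Positive trace class operators: a positive operator is trace class iff `∑ₖ ⟨eₖ, T eₖ⟩ < ∞`. -/
def IsPosTraceClass (T : Op G) : Prop :=
  T.IsPositive ∧ Summable fun k => inner ℂ (stdBasis G k) (T (stdBasis G k))

/-- The von Neumann algebra generated by a set of operators: the double commutant of `S ∪ S*`. -/
def vNGenerated (S : Set (Op G)) : StarSubalgebra ℂ (Op G) :=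
  StarSubalgebra.centralizer ℂ (StarSubalgebra.centralizer ℂ S : Set (Op G))

end Operators

/-! ### Quantum Markov chains -/

section QMC

variable {G : Type u} [NormedAddCommGroup G] [InnerProductSpace ℂ G]

/-- `nested E a m l y = E⁽ᵐ⁾(aₘ ⊗ E⁽ᵐ⁺¹⁾(aₘ₊₁ ⊗ ⋯ E⁽ᵐ⁺ˡ⁻¹⁾(aₘ₊ₗ₋₁ ⊗ y)))`, with `l` nested maps, where
`E n x y` stands for `E⁽ⁿ⁾(x ⊗ y)`. -/
def nested (E : ℕ → Op G → Op G → Op G) (a : ℕ → Op G) : ℕ → ℕ → Op G → Op G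
  | _, 0, y => y
  | m, l + 1, y => E m (a m) (nested E a (m + 1) l y)

/-- The sequence (in `k`) `E⁽ⁿ⁾(I ⊗ E⁽ⁿ⁺¹⁾(I ⊗ ⋯ E⁽ⁿ⁺ᵏ⁾(I ⊗ I)))`. -/
def bSeq (E : ℕ → Op G → Op G → Op G) (n k : ℕ) : Op G :=
  nested E (fun _ => 1) n (k + 1) 1

/-- The strong limit `b̄(n)` of that sequence. -/
def bBar (E : ℕ → Op G → Op G → Op G) (n : ℕ) : Op G := strongLim (bSeq E n)

variable [CompleteSpace G] {B : StarSubalgebra ℂ (Op G)}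

/-- `E₀](a₀ ⊗ ⋯ ⊗ aₙ ⊗ I ⊗ I ⊗ ⋯) = E⁽⁰⁾(a₀ ⊗ E⁽¹⁾(a₁ ⊗ ⋯ E⁽ⁿ⁾(aₙ ⊗ b̄(n+1))))`. -/
def condExp (E : ℕ → Op G → Op G → Op G) (n : ℕ) (a : ℕ → B) : Op G :=
  nested E (fun k => (a k : Op G)) 0 (n + 1) (bBar E (n + 1))

/-- Finite linear combinations of infinite product elements `a₀ ⊗ a₁ ⊗ a₂ ⊗ ⋯` with all `aₖ` in `B`,
with the multiplication `(⊗ aₖ)(⊗ bₖ) = ⊗ aₖbₖ`. -/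
abbrev ProductAlgebra (B : StarSubalgebra ℂ (Op G)) := MonoidAlgebra ℂ (ℕ → B)

/-- `E₀](a) = x` for a linear combination `a` of product elements: `x` is the strong limit of the
values of `E₀]` at the truncations `a₀ ⊗ ⋯ ⊗ aₙ ⊗ I ⊗ I ⊗ ⋯`. -/
def HasCondExp (E : ℕ → Op G → Op G → Op G) (a : ProductAlgebra B) (x : Op G) : Prop :=
  StrongTendsto (fun n => a.coeff.sum fun s c => c • condExp E n s) x

/-- The factors of `I ⊗ ⋯ ⊗ I ⊗ p ⊗ p ⊗ ⋯`, where the first `p` stands at place `n₀`. -/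
def tailSeq (p : B) (n₀ : ℕ) : ℕ → B := fun k => if k < n₀ then 1 else p

/-- The element `p_[n₀ = I ⊗ ⋯ ⊗ I ⊗ p ⊗ p ⊗ ⋯`. -/
def tailProj (p : B) (n₀ : ℕ) : ProductAlgebra B := MonoidAlgebra.of ℂ (ℕ → B) (tailSeq p n₀)

/-- Mutually commuting copies `J₀(B), J₁(B), …` of the one-site algebra on a Hilbert space `K`. Every
realisation of the infinite tensor product `B ⊗ B ⊗ ⋯` on a Hilbert space (on the complete tensor
product, on an incomplete one, in the universal representation of the quasi-local algebra, …), with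
`Jₙ(a) = I ⊗ ⋯ ⊗ I ⊗ a ⊗ I ⊗ ⋯`, is of this kind. -/
structure Copies (B : StarSubalgebra ℂ (Op G)) (K : Type w) [NormedAddCommGroup K]
    [InnerProductSpace ℂ K] [CompleteSpace K] where
  J : ℕ → B →⋆ₐ[ℂ] Op K
  commute : ∀ m n, m ≠ n → ∀ a b : B, Commute (J m a) (J n b)

namespace Copies

variable {K : Type w} [NormedAddCommGroup K] [InnerProductSpace ℂ K] [CompleteSpace K]

/-- The von Neumann algebra generated by the copies. -/
def algebra (R : Copies B K) : StarSubalgebra ℂ (Op K) :=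
  vNGenerated (⋃ n, Set.range (R.J n))

/-- `J₀(a₀) J₁(a₁) ⋯ Jₙ(aₙ)`, that is, `a₀ ⊗ ⋯ ⊗ aₙ ⊗ I ⊗ I ⊗ ⋯`. -/
def prodUpTo (R : Copies B K) (n : ℕ) (a : ℕ → B) : Op K :=
  ((List.range (n + 1)).map fun k => R.J k (a k)).prod

/-- The infinite product element `a₀ ⊗ a₁ ⊗ ⋯`, as the strong limit of `a₀ ⊗ ⋯ ⊗ aₙ ⊗ I ⊗ ⋯`. -/
def IsInfProd (R : Copies B K) (a : ℕ → B) (T : Op K) : Prop :=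
  StrongTendsto (fun n => R.prodUpTo n a) T

/-- A positive linear map on the generated von Neumann algebra which is the map `E₀]` given by the
sequence `E`: its values at the (finite and infinite) product elements are
`lim E⁽⁰⁾(a₀ ⊗ E⁽¹⁾(a₁ ⊗ ⋯ E⁽ⁿ⁾(aₙ ⊗ b̄(n+1))))`. -/
structure IsCondExp (R : Copies B K) (E : ℕ → Op G → Op G → Op G)
    (F : R.algebra →ₗ[ℂ] Op G) : Prop where
  pos : ∀ a : R.algebra, (F (star a * a)).IsPositive
  prod : ∀ (a : ℕ → B) (T : R.algebra), R.IsInfProd a (T : Op K) →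
    StrongTendsto (fun n => condExp E n a) (F T)

end Copies

/-- The pair of the functional `φ₀` and the sequence `E` is a Markov pair (a quantum Markov chain) over
the algebra `B`: the limits `b̄(n)` exist, the formula for `E₀]` at finite product elements is
consistent with the passage to the limit, and `φ₀(E₀](I ⊗ I ⊗ ⋯)) = 1`. -/
structure IsMarkovPair (B : StarSubalgebra ℂ (Op G)) (φ₀ : Op G → ℂ)
    (E : ℕ → Op G → Op G → Op G) : Prop where
  bBar_exists : ∀ n, ∃ b, StrongTendsto (bSeq E n) b
  consistent : ∀ (n : ℕ) (a : ℕ → B), (∀ k, n < k → a k = 1) →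
    StrongTendsto (fun m => condExp E m a) (condExp E n a)
  markov : ∃ x, HasCondExp E (1 : ProductAlgebra B) x ∧ φ₀ x = 1

/-- `p_[n₀` is a reducing projection: `p` is a nontrivial projection in `B` and
`E₀](p_[n₀ a p_[n₀) = E₀](a)` for all `a`. This is required both for the linear combinations `a` of
product elements, on which `E₀]` is given by its explicit formula, and for all elements `a` of the
generated von Neumann algebra, in every realisation on which `E₀]` is defined. -/
structure IsReducing (E : ℕ → Op G → Op G → Op G) (p : B) (n₀ : ℕ) : Prop where
  proj : IsStarProjection p
  ne_zero : p ≠ 0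
  ne_one : p ≠ 1
  products : ∀ (a : ProductAlgebra B) (x : Op G),
    HasCondExp E (tailProj p n₀ * a * tailProj p n₀) x ↔ HasCondExp E a x
  vonNeumann : ∀ (K : Type w) [NormedAddCommGroup K] [InnerProductSpace ℂ K] [CompleteSpace K]
    (R : Copies B K) (F : R.algebra →ₗ[ℂ] Op G), R.IsCondExp E F →
    ∃ P : R.algebra, R.IsInfProd (tailSeq p n₀) (P : Op K) ∧ ∀ a, F (P * a * P) = F a

/-- The chain over `B` given by the sequence `E` is reducible. -/
def IsReducible (B : StarSubalgebra ℂ (Op G)) (E : ℕ → Op G → Op G → Op G) : Prop :=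
  ∃ (p : B) (n₀ : ℕ), IsReducing.{u, w} E p n₀

end QMC

/-! ### Open quantum random walks -/

section Walk

variable {H : Type u} [NormedAddCommGroup H] [InnerProductSpace ℂ H] {Λ : Type v}

/-- A path `i = i₀, i₁, …, iₗ = j` with `l ≥ 1` from `i` to `j`. -/
inductive SitePath (Λ : Type v) : Λ → Λ → Type v
  | single (i j : Λ) : SitePath Λ i j
  | cons (i : Λ) {k j : Λ} (π : SitePath Λ k j) : SitePath Λ i j

/-- `B_π = B^{iₗ}_{iₗ₋₁} ⋯ B^{i₁}_{i₀}`, where `b i j` is `B^i_j`, the effect of passing from `j`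
to `i`. -/
def pathOp (b : Λ → Λ → Op H) : {i j : Λ} → SitePath Λ i j → Op H
  | _, _, .single i j => b j i
  | _, _, .cons (k := k) i π => pathOp b π * b k i

variable [CompleteSpace H]

variable (H Λ) in
/-- The Hilbert space `ℋ ⊗ 𝒦`, where `𝒦` has the orthonormal basis `(|i⟩)` indexed by `Λ`, as `ℓ²(Λ; ℋ)`:
`ξ ⊗ |i⟩` is the function with value `ξ` at `i` and `0` elsewhere. -/
abbrev Site := lp (fun _ : Λ => H) 2

open Classical in
variable (H) in
/-- The isometry `ξ ↦ ξ ⊗ |i⟩`. -/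
def ket (i : Λ) : H →L[ℂ] Site H Λ := lp.singleContinuousLinearMap ℂ (fun _ : Λ => H) 2 i

/-- The operator `a ⊗ |i⟩⟨j|`. -/
def elem (a : Op H) (i j : Λ) : Op (Site H Λ) :=
  ket H i ∘L a ∘L ContinuousLinearMap.adjoint (ket H j)

/-- The `j`-th diagonal block of an operator on `ℋ ⊗ 𝒦`. -/
def block (T : Op (Site H Λ)) (j : Λ) : Op H :=
  ContinuousLinearMap.adjoint (ket H j) ∘L T ∘L ket H j

variable (H Λ) in
/-- The operators `∑ᵢ a(i) ⊗ |i⟩⟨i|` with `∑ᵢ ‖a(i)‖ < ∞`. -/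
def blockAlg₀ : Set (Op (Site H Λ)) :=
  {T | ∃ a : Λ → Op H, (Summable fun i => ‖a i‖) ∧ T = ∑' i, elem (a i) i i}

variable (H Λ) in
/-- The von Neumann algebra `ℬ` of block-diagonal operators: the weak closure of the previous set, that
is, its double commutant. -/
def blockAlg : StarSubalgebra ℂ (Op (Site H Λ)) := vNGenerated (blockAlg₀ H Λ)

/-- `∑ᵢ (Bⁱⱼ)* Bⁱⱼ = I` strongly, for each `j`. -/
def IsWalk (b : Λ → Λ → Op H) : Prop :=
  ∀ (j : Λ) (ξ : H), HasSum (fun i => ContinuousLinearMap.adjoint (b i j) (b i j ξ)) ξ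

/-- The blocks of a density matrix `∑ᵢ ρᵢ ⊗ |i⟩⟨i|`. -/
structure IsBlockDensity (ρ : Λ → Op H) : Prop where
  posTrace : ∀ i, IsPosTraceClass (ρ i)
  total : HasSum (fun i => opTrace (ρ i)) 1

/-- `Mⁱⱼ = Bⁱⱼ ⊗ |i⟩⟨j|`. -/
def hop (b : Λ → Λ → Op H) (i j : Λ) : Op (Site H Λ) := elem (b i j) i j

/-- One step `ρ ↦ ∑ᵢ ∑ⱼ Mⁱⱼ ρ (Mⁱⱼ)*` of the walk. -/
def step (b : Λ → Λ → Op H) (ρ : Op (Site H Λ)) : Op (Site H Λ) :=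
  ∑' i, ∑' j, hop b i j * ρ * star (hop b i j)

/-- The initial density matrix `∑ᵢ ρᵢ ⊗ |i⟩⟨i|`. -/
def initial (ρ : Λ → Op H) : Op (Site H Λ) := ∑' i, elem (ρ i) i i

/-- The state `ρ⁽ⁿ⁾` of the walk at time `n`. -/
def stateAt (b : Λ → Λ → Op H) (ρ : Λ → Op H) (n : ℕ) : Op (Site H Λ) :=
  (step b)^[n] (initial ρ)

/-- The block `ρ⁽ⁿ⁾ⱼ` of the state at time `n`. -/
def stateBlock (b : Λ → Λ → Op H) (ρ : Λ → Op H) (n : ℕ) (j : Λ) : Op H :=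
  block (stateAt b ρ n) j

open Classical in
/-- The transition expectations
`E⁽ⁿ⁾(x ⊗ y) = ∑_{j : ρ⁽ⁿ⁾ⱼ ≠ 0} ∑ᵢ Tr((ρ⁽ⁿ⁾ⱼ ⊗ |j⟩⟨j|) x) / Tr(ρ⁽ⁿ⁾ⱼ) • (Mⁱⱼ)* y Mⁱⱼ`. -/
def transition (b : Λ → Λ → Op H) (ρ : Λ → Op H) (n : ℕ) (x y : Op (Site H Λ)) :
    Op (Site H Λ) :=
  strongSum fun ij : Λ × Λ =>
    if stateBlock b ρ n ij.2 = 0 then 0 else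
      (opTrace (elem (stateBlock b ρ n ij.2) ij.2 ij.2 * x) / opTrace (stateBlock b ρ n ij.2)) •
        (star (hop b ij.1 ij.2) * y * hop b ij.1 ij.2)

/-- The initial state as a functional, `x ↦ Tr(ρ⁽⁰⁾ x)`. -/
def initialState (ρ : Λ → Op H) (x : Op (Site H Λ)) : ℂ := opTrace (initial ρ * x)

end Walk

end OQRW

end

noncomputable section

namespace OQRW

open scoped ComplexOrder InnerProductSpace
open InnerProductSpace (rankOne)

section Strong

variable {G : Type u} [NormedAddCommGroup G] [InnerProductSpace ℂ G]

theorem StrongTendsto.unique {f : ℕ → Op G} {S T : Op G} (hS : StrongTendsto f S)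
    (hT : StrongTendsto f T) : S = T :=
  ContinuousLinearMap.ext fun ξ => tendsto_nhds_unique (hS ξ) (hT ξ)

theorem StrongTendsto.shift {f : ℕ → Op G} {T : Op G} (hT : StrongTendsto f T) (k : ℕ) :
    StrongTendsto (fun n => f (n + k)) T :=
  fun ξ => (tendsto_add_atTop_iff_nat k).2 (hT ξ)

theorem StrongTendsto.strongLim_eq {f : ℕ → Op G} {T : Op G} (hT : StrongTendsto f T) :
    strongLim f = T := by
  have h : ∃ T, StrongTendsto f T := ⟨T, hT⟩
  rw [strongLim, dif_pos h]
  exact h.choose_spec.unique hT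

theorem strongSum_eq {ι : Type*} {f : ι → Op G} {T : Op G}
    (hT : ∀ ξ, HasSum (fun i => f i ξ) (T ξ)) : strongSum f = T := by
  have h : ∃ T : Op G, ∀ ξ, HasSum (fun i => f i ξ) (T ξ) := ⟨T, hT⟩
  rw [strongSum, dif_pos h]
  exact ContinuousLinearMap.ext fun ξ => (h.choose_spec ξ).unique (hT ξ)

theorem isPositive_of_inner_nonneg {T : Op G} (hT : ∀ ξ, 0 ≤ ⟪ξ, T ξ⟫_ℂ) : T.IsPositive := by
  rw [ContinuousLinearMap.isPositive_iff_complex]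
  intro ξ
  have h := hT ξ
  rw [← inner_conj_symm] at h
  obtain ⟨h1, h2⟩ := Complex.nonneg_iff.1 h
  rw [Complex.conj_re] at h1
  rw [Complex.conj_im] at h2
  refine ⟨Complex.ext ?_ ?_, h1⟩
  · simp
  · simp only [RCLike.re_to_complex, Complex.ofReal_im]
    linarith

variable [CompleteSpace G]

theorem norm_apply_sq_le {D : Op G} (hD : 0 ≤ D) (ξ : G) :
    ‖D ξ‖ ^ 2 ≤ ‖D‖ * (⟪ξ, D ξ⟫_ℂ).re := by
  set S := CFC.sqrt D
  have hS : S * S = D := CFC.sqrt_mul_sqrt_self D hD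
  have hSa : IsSelfAdjoint S := (CFC.sqrt_nonneg D).isSelfAdjoint
  have h1 : ‖S‖ * ‖S‖ = ‖D‖ := by
    rw [← hS, hSa.norm_mul_self, sq]
  have h2 : (⟪ξ, D ξ⟫_ℂ).re = ‖S ξ‖ ^ 2 := by
    rw [← hS, mul_apply_eq_comp, ← ContinuousLinearMap.adjoint_inner_left,
      ← ContinuousLinearMap.star_eq_adjoint, hSa.star_eq, inner_self_eq_norm_sq_to_K]
    norm_cast
  have h3 : ‖D ξ‖ ≤ ‖S‖ * ‖S ξ‖ := by
    rw [← hS, mul_apply_eq_comp]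
    exact S.le_opNorm _
  calc ‖D ξ‖ ^ 2 ≤ (‖S‖ * ‖S ξ‖) ^ 2 := by gcongr
    _ = _ := by rw [h2, ← h1]; ring

theorem exists_strongTendsto_of_antitone {T : ℕ → Op G} (hpos : ∀ n, 0 ≤ T n)
    (hT : Antitone T) : ∃ S, StrongTendsto T S := by
  have key : ∀ ξ, CauchySeq fun n => T n ξ := by
    intro ξ
    have hre : ∀ n, (⟪ξ, T n ξ⟫_ℂ).re ∈ Set.Ici (0 : ℝ) := fun n =>
      (Complex.nonneg_iff.1
        (((ContinuousLinearMap.nonneg_iff_isPositive _).1 (hpos n)).inner_nonneg_right ξ)).1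
    have hmono : Antitone fun n => (⟪ξ, T n ξ⟫_ℂ).re := by
      intro m n hmn
      have := (Complex.nonneg_iff.1 (((ContinuousLinearMap.le_def _ _).1
        (hT hmn)).inner_nonneg_right ξ)).1
      simp only [sub_apply, inner_sub_right, Complex.sub_re] at this
      linarith
    have hc : CauchySeq fun n => (⟪ξ, T n ξ⟫_ℂ).re :=
      (tendsto_atTop_ciInf hmono ⟨0, by rintro _ ⟨n, rfl⟩; exact hre n⟩).cauchySeq
    have hle : ∀ m n, m ≤ n → ‖T m ξ - T n ξ‖ ^ 2 ≤
        ‖T 0‖ * dist (⟪ξ, T m ξ⟫_ℂ).re (⟪ξ, T n ξ⟫_ℂ).re := by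
      intro m n hmn
      have hD : 0 ≤ T m - T n := sub_nonneg.2 (hT hmn)
      have h1 : ‖T m - T n‖ ≤ ‖T 0‖ :=
        CStarAlgebra.norm_le_norm_of_nonneg_of_le hD
          ((sub_le_self _ (hpos n)).trans (hT (Nat.zero_le m)))
      have h2 := norm_apply_sq_le hD ξ
      simp only [sub_apply, inner_sub_right, Complex.sub_re] at h2
      have h3 : (⟪ξ, T m ξ⟫_ℂ).re - (⟪ξ, T n ξ⟫_ℂ).re ≤
          dist (⟪ξ, T m ξ⟫_ℂ).re (⟪ξ, T n ξ⟫_ℂ).re := le_abs_self _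
      exact h2.trans (mul_le_mul h1 h3 (sub_nonneg.2 (hmono hmn)) (norm_nonneg _))
    rw [Metric.cauchySeq_iff] at hc ⊢
    intro ε hε
    obtain ⟨N, hN⟩ := hc (ε ^ 2 / (‖T 0‖ + 1)) (by positivity)
    have main : ∀ m ≥ N, ∀ n ≥ N, m ≤ n → ‖T m ξ - T n ξ‖ < ε := by
      intro m hm n hn hmn
      refine lt_of_pow_lt_pow_left₀ 2 hε.le ((hle m n hmn).trans_lt ?_)
      have h4 := hN m hm n hn
      rw [lt_div_iff₀ (by positivity)] at h4
      nlinarith [dist_nonneg (x := (⟪ξ, T m ξ⟫_ℂ).re) (y := (⟪ξ, T n ξ⟫_ℂ).re),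
        norm_nonneg (T 0)]
    refine ⟨N, fun m hm n hn => ?_⟩
    rcases le_total m n with hmn | hmn
    · rw [dist_eq_norm]; exact main m hm n hn hmn
    · rw [dist_comm, dist_eq_norm]; exact main n hn m hm hmn
  choose f hf using fun ξ => cauchySeq_tendsto_of_complete (key ξ)
  exact ⟨continuousLinearMapOfTendsto T (f := f) (tendsto_pi_nhds.2 hf), hf⟩

end Strong

section Sums

theorem hasSum_prod_of_nonneg {α β : Type*} {f : α × β → ℝ} {g : α → ℝ} {s : ℝ}
    (hf : ∀ x, 0 ≤ f x) (hfg : ∀ a, HasSum (fun b => f (a, b)) (g a)) (hg : HasSum g s) :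
    HasSum f s := by
  have hs : Summable f := (summable_prod_of_nonneg hf).2
    ⟨fun a => (hfg a).summable, by simpa only [(hfg _).tsum_eq] using hg.summable⟩
  have := hs.hasSum.prod_fiberwise hfg
  rw [hg.unique this]
  exact hs.hasSum

theorem tendsto_lp_two {ι : Type*} {F : Type*} [NormedAddCommGroup F]
    {f : ℕ → lp (fun _ : ι => F) 2} {f₀ : lp (fun _ : ι => F) 2} {g : ι → ℝ}
    (hg : Summable fun i => g i ^ 2) (hfg : ∀ n i, ‖f n i‖ ≤ g i)
    (hlim : ∀ i, Tendsto (fun n => f n i) atTop (𝓝 (f₀ i))) : Tendsto f atTop (𝓝 f₀) := by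
  rw [tendsto_iff_norm_sub_tendsto_zero]
  have h0 : ∀ i, ‖f₀ i‖ ≤ g i := fun i =>
    le_of_tendsto (hlim i).norm (Eventually.of_forall fun n => hfg n i)
  have hsum : ∀ n, ‖f n - f₀‖ ^ 2 = ∑' i, ‖f n i - f₀ i‖ ^ 2 := by
    intro n
    have := lp.norm_rpow_eq_tsum (p := 2) (by norm_num) (f n - f₀)
    simpa using this
  have h1 : Tendsto (fun n => ∑' i, ‖f n i - f₀ i‖ ^ 2) atTop (𝓝 (∑' _ : ι, (0 : ℝ))) := by
    refine tendsto_tsum_of_dominated_convergence (bound := fun i => 4 * g i ^ 2)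
      (hg.mul_left 4) (fun i => ?_) (Eventually.of_forall fun n i => ?_)
    · have := ((hlim i).sub_const (f₀ i)).norm.pow 2
      simpa using this
    · rw [Real.norm_of_nonneg (by positivity)]
      have := (norm_sub_le (f n i) (f₀ i)).trans (add_le_add (hfg n i) (h0 i))
      calc ‖f n i - f₀ i‖ ^ 2 ≤ (g i + g i) ^ 2 := by gcongr
        _ = 4 * g i ^ 2 := by ring
  simp only [← hsum, tsum_zero] at h1
  simpa using h1.sqrt

end Sums

section Kraus

variable {G : Type u} [NormedAddCommGroup G] [InnerProductSpace ℂ G] {κ : Type v}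

/-- The isometry `ξ ↦ (Mₖ ξ)ₖ` into a Hilbert sum. -/
def column (M : κ → Op G) (hM : ∀ ξ, HasSum (fun k => ‖M k ξ‖ ^ 2) (‖ξ‖ ^ 2)) :
    G →L[ℂ] lp (fun _ : κ => G) 2 :=
  LinearMap.mkContinuous
    { toFun := fun ξ => ⟨fun k => M k ξ, memℓp_gen (by simpa using (hM ξ).summable)⟩
      map_add' := fun _ _ => by ext; exact map_add _ _ _
      map_smul' := fun _ _ => by ext; exact map_smul _ _ _ } 1 fun ξ => by
    have h := lp.norm_rpow_eq_tsum (p := 2) (by norm_num)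
      (⟨fun k => M k ξ, memℓp_gen (by simpa using (hM ξ).summable)⟩ : lp (fun _ : κ => G) 2)
    simp only [ENNReal.toReal_ofNat, Real.rpow_ofNat, (hM ξ).tsum_eq] at h
    rw [one_mul]
    exact (pow_le_pow_iff_left₀ (norm_nonneg _) (norm_nonneg _) two_ne_zero).1 h.le

theorem column_apply (M : κ → Op G) (hM : ∀ ξ, HasSum (fun k => ‖M k ξ‖ ^ 2) (‖ξ‖ ^ 2)) (ξ : G)
    (k : κ) : column M hM ξ k = M k ξ := rfl

theorem norm_column_le (M : κ → Op G) (hM : ∀ ξ, HasSum (fun k => ‖M k ξ‖ ^ 2) (‖ξ‖ ^ 2)) :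
    ‖column M hM‖ ≤ 1 := LinearMap.mkContinuous_norm_le _ zero_le_one _

variable [CompleteSpace G]

open Classical in
theorem adjoint_column_single (M : κ → Op G)
    (hM : ∀ ξ, HasSum (fun k => ‖M k ξ‖ ^ 2) (‖ξ‖ ^ 2)) (k : κ) (η : G) :
    ContinuousLinearMap.adjoint (column M hM) (lp.single 2 k η) = star (M k) η := by
  refine ext_inner_right ℂ fun ζ => ?_
  rw [ContinuousLinearMap.adjoint_inner_left, lp.inner_single_left, column_apply,
    ContinuousLinearMap.star_eq_adjoint, ContinuousLinearMap.adjoint_inner_left]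

/-- The operator `∑ₖ cₖ Mₖ* y Mₖ`. -/
def kraus (M : κ → Op G) (hM : ∀ ξ, HasSum (fun k => ‖M k ξ‖ ^ 2) (‖ξ‖ ^ 2)) {c : κ → ℂ} {C : ℝ}
    (hC : 0 ≤ C) (hc : ∀ k, ‖c k‖ ≤ C) (y : Op G) : Op G :=
  ContinuousLinearMap.adjoint (column M hM) ∘L
    lp.mapCLM 2 (fun k => c k • y) (K := C * ‖y‖) (by positivity)
      (fun k => by rw [norm_smul]; gcongr; exact hc k) ∘L column M hM

variable (M : κ → Op G) (hM : ∀ ξ, HasSum (fun k => ‖M k ξ‖ ^ 2) (‖ξ‖ ^ 2)) {c : κ → ℂ} {C : ℝ}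
  (hC : 0 ≤ C) (hc : ∀ k, ‖c k‖ ≤ C)

theorem hasSum_kraus (y : Op G) (ξ : G) :
    HasSum (fun k => (c k • (star (M k) * y * M k)) ξ) (kraus M hM hC hc y ξ) := by
  classical
  have h := (lp.hasSum_single (p := 2) (by norm_num)
    ((lp.mapCLM 2 (fun k => c k • y) (K := C * ‖y‖) (by positivity)
      (fun k => by rw [norm_smul]; gcongr; exact hc k) ∘L column M hM) ξ)).mapL
    (ContinuousLinearMap.adjoint (column M hM))
  simp only [adjoint_column_single] at h
  convert! h using 1
  ext k
  simp [column_apply]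

theorem norm_kraus_le (y : Op G) : ‖kraus M hM hC hc y‖ ≤ C * ‖y‖ := by
  have h1 := norm_column_le M hM
  have h2 := lp.norm_mapCLM_le 2 (fun k => c k • y) (K := C * ‖y‖) (by positivity)
      (fun k => by rw [norm_smul]; gcongr; exact hc k)
  calc ‖kraus M hM hC hc y‖ ≤ ‖ContinuousLinearMap.adjoint (column M hM)‖ *
        (‖lp.mapCLM 2 (fun k => c k • y) (K := C * ‖y‖) (by positivity)
      (fun k => by rw [norm_smul]; gcongr; exact hc k)‖ * ‖column M hM‖) :=
        (ContinuousLinearMap.opNorm_comp_le _ _).trans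
          (by gcongr; exact ContinuousLinearMap.opNorm_comp_le _ _)
    _ ≤ 1 * (C * ‖y‖ * 1) := by
      rw [LinearIsometryEquiv.norm_map]
      gcongr
    _ = _ := by ring

theorem strongTendsto_kraus {y : ℕ → Op G} {y₀ : Op G} {K : ℝ} (hK : ∀ n, ‖y n‖ ≤ K)
    (hy : StrongTendsto y y₀) :
    StrongTendsto (fun n => kraus M hM hC hc (y n)) (kraus M hM hC hc y₀) := by
  intro ξ
  refine ((ContinuousLinearMap.adjoint (column M hM)).continuous.tendsto _).comp ?_
  refine tendsto_lp_two (g := fun k => C * K * ‖M k ξ‖) ?_ (fun n k => ?_) (fun k => ?_)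
  · simp only [mul_pow]
    exact (hM ξ).summable.mul_left _
  · have hK0 : 0 ≤ K := (norm_nonneg _).trans (hK n)
    change ‖c k • y n (M k ξ)‖ ≤ _
    rw [norm_smul]
    calc ‖c k‖ * ‖y n (M k ξ)‖ ≤ C * (K * ‖M k ξ‖) := by
          gcongr
          · exact hc k
          · exact (y n).le_of_opNorm_le (hK n) _
      _ = _ := by ring
  · change Tendsto (fun n => c k • y n (M k ξ)) _ (𝓝 (c k • y₀ (M k ξ)))
    exact (hy _).const_smul _

end Kraus

section Decomp

variable {G : Type u} [NormedAddCommGroup G] [InnerProductSpace ℂ G] {ι : Type v}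

/-- `T = ∑ᵢ |uᵢ⟩⟨uᵢ|` with `∑ᵢ ‖uᵢ‖² < ∞`. -/
structure HasDecomp (T : Op G) (u : ι → G) : Prop where
  summable : Summable fun i => ‖u i‖ ^ 2
  hasSum : HasSum (fun i => rankOne ℂ (u i) (u i)) T

theorem summable_rankOne [CompleteSpace G] {u : ι → G} (hu : Summable fun i => ‖u i‖ ^ 2) :
    Summable fun i => rankOne ℂ (u i) (u i) :=
  Summable.of_norm (by simpa [← sq] using hu)

theorem hasSum_norm_inner_sq {κ : Type*} (e : HilbertBasis κ ℂ G) (x : G) :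
    HasSum (fun k => ‖⟪e k, x⟫_ℂ‖ ^ 2) (‖x‖ ^ 2) := by
  have h := (e.hasSum_inner_mul_inner x x).mapL Complex.reCLM
  have h2 : (⟪x, x⟫_ℂ).re = ‖x‖ ^ 2 := by
    rw [inner_self_eq_norm_sq_to_K]; norm_cast
  rw [Complex.reCLM_apply, h2] at h
  convert! h using 1
  ext k
  rw [Complex.reCLM_apply, ← inner_conj_symm x, mul_comm, Complex.mul_conj,
    Complex.normSq_eq_norm_sq, Complex.ofReal_re]

theorem summable_norm_inner_sq {κ : Type*} (e : HilbertBasis κ ℂ G) {u : ι → G}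
    (hu : Summable fun i => ‖u i‖ ^ 2) :
    Summable fun x : ι × κ => ‖⟪e x.2, u x.1⟫_ℂ‖ ^ 2 :=
  (hasSum_prod_of_nonneg (fun _ => by positivity) (fun i => hasSum_norm_inner_sq e (u i))
    hu.hasSum).summable

variable [CompleteSpace G] {T : Op G} {u : ι → G}

theorem HasDecomp.hasSum_opTrace (h : HasDecomp T u) (A : Op G) :
    HasSum (fun i => ⟪u i, A (u i)⟫_ℂ) (opTrace (T * A)) := by
  set e := stdBasis G
  set A' := ContinuousLinearMap.adjoint A
  have hA : Summable fun i => ‖A' (u i)‖ ^ 2 := by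
    refine Summable.of_nonneg_of_le (fun _ => by positivity) (fun i => ?_)
      (h.summable.mul_left (‖A'‖ ^ 2))
    rw [← mul_pow]
    gcongr
    exact A'.le_opNorm _
  have hs : Summable fun x : ι × basisIndex G =>
      ⟪A' (u x.1), e x.2⟫_ℂ * ⟪e x.2, u x.1⟫_ℂ := by
    refine Summable.of_norm_bounded
      ((summable_norm_inner_sq e hA).add (summable_norm_inner_sq e h.summable)) fun x => ?_
    rw [norm_mul, norm_inner_symm]
    nlinarith [sq_nonneg (‖⟪e x.2, A' (u x.1)⟫_ℂ‖ - ‖⟪e x.2, u x.1⟫_ℂ‖),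
      sq_nonneg ‖⟪e x.2, A' (u x.1)⟫_ℂ‖, sq_nonneg ‖⟪e x.2, u x.1⟫_ℂ‖]
  have hrow : ∀ i, HasSum (fun k => ⟪A' (u i), e k⟫_ℂ * ⟪e k, u i⟫_ℂ) ⟪u i, A (u i)⟫_ℂ := by
    intro i
    rw [← ContinuousLinearMap.adjoint_inner_left]
    exact e.hasSum_inner_mul_inner _ _
  have hcol : ∀ k, HasSum (fun i => ⟪A' (u i), e k⟫_ℂ * ⟪e k, u i⟫_ℂ)
      ⟪e k, (T * A) (e k)⟫_ℂ := by
    intro k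
    have h1 := (h.hasSum.mapL (ContinuousLinearMap.apply ℂ G (A (e k)))).mapL (innerSL ℂ (e k))
    convert! h1 using 1
    ext i
    simp [A', ContinuousLinearMap.adjoint_inner_left]
  have h1 := hs.hasSum.prod_fiberwise hrow
  have h2 := ((Equiv.prodComm _ _).hasSum_iff.2 hs.hasSum).prod_fiberwise hcol
  rw [opTrace, h2.tsum_eq]
  exact h1

theorem HasDecomp.hasSum_norm_sq (h : HasDecomp T u) :
    HasSum (fun i => ((‖u i‖ ^ 2 : ℝ) : ℂ)) (opTrace T) := by
  have := h.hasSum_opTrace 1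
  rw [mul_one] at this
  convert! this using 1
  ext i
  simp [inner_self_eq_norm_sq_to_K]

theorem HasDecomp.eq_zero (h : HasDecomp T u) (hT : T = 0) (i : ι) : u i = 0 := by
  have h1 := h.hasSum_norm_sq
  have h2 : opTrace T = ((0 : ℝ) : ℂ) := by simp [hT, opTrace]
  rw [h2, Complex.hasSum_ofReal, hasSum_zero_iff_of_nonneg fun _ => by positivity] at h1
  simpa using congrFun h1 i

theorem HasDecomp.opTrace_ne_zero (h : HasDecomp T u) (hT : T ≠ 0) : opTrace T ≠ 0 := by
  intro h0
  apply hT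
  have h1 := h.hasSum_norm_sq
  have h2 : opTrace T = ((0 : ℝ) : ℂ) := by simp [h0]
  rw [h2, Complex.hasSum_ofReal, hasSum_zero_iff_of_nonneg fun _ => by positivity] at h1
  have h3 : ∀ i, u i = 0 := fun i => by simpa using congrFun h1 i
  have h4 := h.hasSum
  simp only [h3, map_zero] at h4
  exact h4.unique hasSum_zero

theorem HasDecomp.norm_opTrace_mul_le (h : HasDecomp T u) (A : Op G) :
    ‖opTrace (T * A)‖ ≤ ‖A‖ * ‖opTrace T‖ := by
  have h2 : opTrace T = ((∑' i, ‖u i‖ ^ 2 : ℝ) : ℂ) :=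
    h.hasSum_norm_sq.unique (Complex.hasSum_ofReal.2 h.summable.hasSum)
  rw [h2, Complex.norm_real, Real.norm_of_nonneg (tsum_nonneg fun _ => by positivity),
    ← (h.hasSum_opTrace A).tsum_eq, ← tsum_mul_left]
  refine tsum_of_norm_bounded (h.summable.mul_left ‖A‖).hasSum fun i => ?_
  calc ‖⟪u i, A (u i)⟫_ℂ‖ ≤ ‖u i‖ * (‖A‖ * ‖u i‖) :=
        (norm_inner_le_norm _ _).trans (by gcongr; exact A.le_opNorm _)
    _ = _ := by ring

theorem HasDecomp.map {G' : Type*} [NormedAddCommGroup G'] [InnerProductSpace ℂ G']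
    [CompleteSpace G'] (h : HasDecomp T u) (X : G →L[ℂ] G') :
    HasDecomp (X ∘L T ∘L ContinuousLinearMap.adjoint X) fun i => X (u i) where
  summable := by
    refine Summable.of_nonneg_of_le (fun _ => by positivity) (fun i => ?_)
      (h.summable.mul_left (‖X‖ ^ 2))
    rw [← mul_pow]
    gcongr
    exact X.le_opNorm _
  hasSum := by
    have := h.hasSum.mapL ((ContinuousLinearMap.compL ℂ G' G G' X) ∘L
      ((ContinuousLinearMap.compL ℂ G' G G).flip (ContinuousLinearMap.adjoint X)))
    convert! this using 1
    ext i ξ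
    simp [ContinuousLinearMap.adjoint_inner_right]

theorem IsPosTraceClass.hasDecomp (hT : IsPosTraceClass T) :
    HasDecomp T fun k => CFC.sqrt T (stdBasis G k) := by
  have hT0 : 0 ≤ T := (ContinuousLinearMap.nonneg_iff_isPositive _).2 hT.1
  set S := CFC.sqrt T
  have hS : S * S = T := CFC.sqrt_mul_sqrt_self T hT0
  have hSa : IsSelfAdjoint S := (CFC.sqrt_nonneg T).isSelfAdjoint
  have hSi : ∀ x y, ⟪S x, y⟫_ℂ = ⟪x, S y⟫_ℂ := fun x y => by
    rw [← ContinuousLinearMap.adjoint_inner_left, ← ContinuousLinearMap.star_eq_adjoint,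
      hSa.star_eq]
  have hn : ∀ x, ((‖S x‖ ^ 2 : ℝ) : ℂ) = ⟪x, T x⟫_ℂ := fun x => by
    rw [← hS, mul_apply_eq_comp, ← hSi, inner_self_eq_norm_sq_to_K]
    norm_cast
  have hs : Summable fun k => ‖S (stdBasis G k)‖ ^ 2 := by
    rw [← Complex.summable_ofReal]
    simpa only [hn] using hT.2
  refine ⟨hs, ?_⟩
  convert! (summable_rankOne hs).hasSum using 1
  ext ξ
  have h1 := (summable_rankOne hs).hasSum.mapL (ContinuousLinearMap.apply ℂ G ξ)
  have h2 := ((stdBasis G).hasSum_repr (S ξ)).mapL S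
  refine HasSum.unique ?_ h1
  rw [← hS]
  convert! h2 using 1
  ext k
  simp [HilbertBasis.repr_apply_apply, hSi]

end Decomp

section Walk

variable {H : Type u} [NormedAddCommGroup H] [InnerProductSpace ℂ H] {Λ : Type v}

theorem ket_apply_self (i : Λ) (η : H) : (ket H i η : Site H Λ) i = η := by
  classical exact lp.single_apply_self ..

theorem norm_ket (i : Λ) (η : H) : ‖(ket H i η : Site H Λ)‖ = ‖η‖ := by
  classical exact lp.norm_single (by norm_num) _ _

variable [CompleteSpace H]

theorem adjoint_ket_apply (j : Λ) (ξ : Site H Λ) :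
    ContinuousLinearMap.adjoint (ket H j) ξ = ξ j := by
  classical
  refine ext_inner_left ℂ fun η => ?_
  rw [ContinuousLinearMap.adjoint_inner_right]
  exact lp.inner_single_left ..

theorem elem_apply (a : Op H) (i j : Λ) (ξ : Site H Λ) : elem a i j ξ = ket H i (a (ξ j)) := by
  simp [elem, adjoint_ket_apply]

theorem hop_apply (b : Λ → Λ → Op H) (i j : Λ) (ξ : Site H Λ) :
    hop b i j ξ = ket H i (b i j (ξ j)) := elem_apply ..

theorem hasSum_norm_hop_sq {b : Λ → Λ → Op H} (hb : IsWalk b) (ξ : Site H Λ) :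
    HasSum (fun x : Λ × Λ => ‖hop b x.1 x.2 ξ‖ ^ 2) (‖ξ‖ ^ 2) := by
  have h1 : ∀ j η, HasSum (fun i => ‖b i j η‖ ^ 2) (‖η‖ ^ 2) := by
    intro j η
    have h := (((hb j η).mapL (innerSL ℂ η))).mapL Complex.reCLM
    simpa [ContinuousLinearMap.adjoint_inner_right, ← Complex.ofReal_pow] using h
  have h2 : HasSum (fun j => ‖ξ j‖ ^ 2) (‖ξ‖ ^ 2) := by
    simpa using lp.hasSum_norm (p := 2) (by norm_num) ξ
  have h3 := hasSum_prod_of_nonneg (f := fun x : Λ × Λ => ‖hop b x.2 x.1 ξ‖ ^ 2)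
    (fun _ => by positivity) (fun j => by simpa [hop_apply, norm_ket] using h1 j (ξ j)) h2
  exact (Equiv.prodComm _ _).hasSum_iff.1 h3

theorem hasSum_norm_hop_sq_family {b : Λ → Λ → Op H} (hb : IsWalk b) {ι : Type w}
    {u : ι → Site H Λ} {s : ℝ} (hu : HasSum (fun l => ‖u l‖ ^ 2) s) :
    HasSum (fun x : (Λ × Λ) × ι => ‖hop b x.1.1 x.1.2 (u x.2)‖ ^ 2) s :=
  (Equiv.prodComm _ _).hasSum_iff.1 (hasSum_prod_of_nonneg
    (f := fun x : ι × Λ × Λ => ‖hop b x.2.1 x.2.2 (u x.1)‖ ^ 2) (fun _ => by positivity)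
    (fun l => hasSum_norm_hop_sq hb (u l)) hu)

theorem HasDecomp.step {b : Λ → Λ → Op H} (hb : IsWalk b) {ι : Type w} {T : Op (Site H Λ)}
    {u : ι → Site H Λ} (h : HasDecomp T u) :
    HasDecomp (step b T) fun x : (Λ × Λ) × ι => hop b x.1.1 x.1.2 (u x.2) := by
  have hs := (hasSum_norm_hop_sq_family hb h.summable.hasSum).summable
  refine ⟨hs, ?_⟩
  have h1 := (summable_rankOne hs).hasSum
  have h2 := h1.prod_fiberwise fun x => (h.map (hop b x.1 x.2)).hasSum
  have h3 := h2.prod_fiberwise fun i => (h2.summable.prod_factor i).hasSum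
  convert! h1 using 1
  exact h3.tsum_eq

theorem IsBlockDensity.hasDecomp {ρ : Λ → Op H} (hρ : IsBlockDensity ρ) :
    HasDecomp (initial ρ)
      (fun x : Λ × basisIndex H => ket H x.1 (CFC.sqrt (ρ x.1) (stdBasis H x.2))) ∧
    HasSum (fun x : Λ × basisIndex H =>
      ‖(ket H x.1 (CFC.sqrt (ρ x.1) (stdBasis H x.2)) : Site H Λ)‖ ^ 2) 1 := by
  have h1 : ∀ i, HasSum (fun k => ‖CFC.sqrt (ρ i) (stdBasis H k)‖ ^ 2) (opTrace (ρ i)).re := by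
    intro i
    simpa [← Complex.ofReal_pow] using (hρ.posTrace i).hasDecomp.hasSum_norm_sq.mapL Complex.reCLM
  have h2 : HasSum (fun i => (opTrace (ρ i)).re) 1 := by
    simpa using hρ.total.mapL Complex.reCLM
  have h3 : HasSum (fun x : Λ × basisIndex H =>
      ‖(ket H x.1 (CFC.sqrt (ρ x.1) (stdBasis H x.2)) : Site H Λ)‖ ^ 2) 1 :=
    hasSum_prod_of_nonneg (fun _ => by positivity) (fun i => by simpa [norm_ket] using h1 i) h2
  refine ⟨⟨h3.summable, ?_⟩, h3⟩
  have h4 := (summable_rankOne h3.summable).hasSum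
  have h5 := h4.prod_fiberwise fun i => ((hρ.posTrace i).hasDecomp.map (ket H i)).hasSum
  convert! h4 using 1
  exact h5.tsum_eq

theorem HasDecomp.block {ι : Type w} {T : Op (Site H Λ)} {u : ι → Site H Λ} (h : HasDecomp T u)
    (j : Λ) : HasDecomp (block T j) fun l => u l j := by
  have := h.map (ContinuousLinearMap.adjoint (ket H j))
  rw [ContinuousLinearMap.adjoint_adjoint] at this
  simp only [adjoint_ket_apply] at this
  exact this

end Walk

section Trace

variable {G : Type u} [NormedAddCommGroup G] [InnerProductSpace ℂ G] [CompleteSpace G]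
  {ι : Type v}

theorem HasDecomp.tendsto_opTrace {T : Op G} {u : ι → G} (h : HasDecomp T u) {y : ℕ → Op G}
    {y₀ : Op G} {K : ℝ} (hK : ∀ n, ‖y n‖ ≤ K) (hy : StrongTendsto y y₀) :
    Tendsto (fun n => opTrace (T * y n)) atTop (𝓝 (opTrace (T * y₀))) := by
  simp only [← (h.hasSum_opTrace _).tsum_eq]
  refine tendsto_tsum_of_dominated_convergence (bound := fun i => K * ‖u i‖ ^ 2)
    (h.summable.mul_left K) (fun i => tendsto_const_nhds.inner (hy (u i)))
    (Eventually.of_forall fun n i => ?_)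
  calc ‖⟪u i, y n (u i)⟫_ℂ‖ ≤ ‖u i‖ * (K * ‖u i‖) :=
        (norm_inner_le_norm _ _).trans (by gcongr; exact (y n).le_of_opNorm_le (hK n) _)
    _ = _ := by ring

end Trace

section Nested

variable {G : Type u} [NormedAddCommGroup G] [InnerProductSpace ℂ G]

theorem nested_succ_last (E : ℕ → Op G → Op G → Op G) (a : ℕ → Op G) (y : Op G) (l m : ℕ) :
    nested E a m (l + 1) y = nested E a m l (E (m + l) (a (m + l)) y) := by
  induction l generalizing m with
  | zero => rfl
  | succ l ih =>
    change E m (a m) (nested E a (m + 1) (l + 1) y) = E m (a m) (nested E a (m + 1) l _)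
    rw [ih, Nat.add_right_comm m 1 l]
    rfl

theorem condExp_eq_of_eventually_one [CompleteSpace G] {B : StarSubalgebra ℂ (Op G)}
    {E : ℕ → Op G → Op G → Op G} (hE : ∀ n, E n 1 (bBar E (n + 1)) = bBar E n) {n : ℕ} {a : ℕ → B}
    (ha : ∀ k, n < k → a k = 1) (k : ℕ) : condExp E (n + k) a = condExp E n a := by
  induction k with
  | zero => rfl
  | succ k ih =>
    rw [← ih, condExp, ← add_assoc, nested_succ_last, ha _ (by omega)]
    simp only [OneMemClass.coe_one, Nat.zero_add, hE]
    rfl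

theorem hasCondExp_one [CompleteSpace G] {B : StarSubalgebra ℂ (Op G)}
    {E : ℕ → Op G → Op G → Op G} (hE : ∀ n, E n 1 (bBar E (n + 1)) = bBar E n) :
    HasCondExp E (1 : ProductAlgebra B) (bBar E 0) := by
  have h : ∀ n, condExp E n (1 : ℕ → B) = bBar E 0 := fun n => by
    have := condExp_eq_of_eventually_one hE (n := 0) (a := (1 : ℕ → B)) (fun _ _ => rfl) n
    rw [Nat.zero_add] at this
    exact this.trans (hE 0)
  intro ξ
  simp [MonoidAlgebra.one_def, h]

end Nested

section Transition

variable {H : Type u} [NormedAddCommGroup H] [InnerProductSpace ℂ H] [CompleteSpace H]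
  {Λ : Type v} {b : Λ → Λ → Op H} {ρ : Λ → Op H}

theorem stateAt_succ (b : Λ → Λ → Op H) (ρ : Λ → Op H) (n : ℕ) :
    stateAt b ρ (n + 1) = step b (stateAt b ρ n) := Function.iterate_succ_apply' ..

theorem exists_hasDecomp_stateAt (hb : IsWalk b) (hρ : IsBlockDensity ρ) (n : ℕ) :
    ∃ (ι : Type (max u v)) (u : ι → Site H Λ), HasDecomp (stateAt b ρ n) u ∧
      HasSum (fun l => ‖u l‖ ^ 2) 1 := by
  induction n with
  | zero => exact ⟨_, _, hρ.hasDecomp⟩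
  | succ n ih =>
    obtain ⟨ι, u, h1, h2⟩ := ih
    rw [stateAt_succ]
    exact ⟨_, _, h1.step hb, hasSum_norm_hop_sq_family hb h2⟩

theorem opTrace_stateAt (hb : IsWalk b) (hρ : IsBlockDensity ρ) (n : ℕ) :
    opTrace (stateAt b ρ n) = 1 := by
  obtain ⟨ι, u, h1, h2⟩ := exists_hasDecomp_stateAt hb hρ n
  have := h1.hasSum_norm_sq.unique (Complex.hasSum_ofReal.2 h2)
  simpa using this

theorem HasDecomp.elem_block {ι : Type w} {T : Op (Site H Λ)} {u : ι → Site H Λ}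
    (h : HasDecomp T u) (j : Λ) :
    HasDecomp (elem (OQRW.block T j) j j) fun l => (ket H j (u l j) : Site H Λ) :=
  (h.block j).map (ket H j)

theorem HasDecomp.opTrace_elem_block {ι : Type w} {T : Op (Site H Λ)} {u : ι → Site H Λ}
    (h : HasDecomp T u) (j : Λ) :
    opTrace (elem (OQRW.block T j) j j) = opTrace (OQRW.block T j) := by
  refine (h.elem_block j).hasSum_norm_sq.unique ?_
  simpa only [norm_ket] using (h.block j).hasSum_norm_sq

open Classical in
/-- The coefficient `Tr((ρ⁽ⁿ⁾ⱼ ⊗ |j⟩⟨j|) x) / Tr(ρ⁽ⁿ⁾ⱼ)` of the transition expectation. -/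
def weight (b : Λ → Λ → Op H) (ρ : Λ → Op H) (n : ℕ) (x : Op (Site H Λ)) (j : Λ) : ℂ :=
  if stateBlock b ρ n j = 0 then 0 else
    opTrace (elem (stateBlock b ρ n j) j j * x) / opTrace (stateBlock b ρ n j)

theorem transition_eq_strongSum (n : ℕ) (x y : Op (Site H Λ)) :
    transition b ρ n x y = strongSum fun ij : Λ × Λ =>
      weight b ρ n x ij.2 • (star (hop b ij.1 ij.2) * y * hop b ij.1 ij.2) := by
  unfold transition weight
  congr 1
  ext1 ij
  split_ifs
  · rw [zero_smul]
  · rfl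

theorem norm_weight_le (hb : IsWalk b) (hρ : IsBlockDensity ρ) (n : ℕ) (x : Op (Site H Λ))
    (j : Λ) : ‖weight b ρ n x j‖ ≤ ‖x‖ := by
  obtain ⟨ι, u, h1, -⟩ := exists_hasDecomp_stateAt hb hρ n
  unfold weight
  split_ifs with h0
  · simp
  · have hpos : 0 < ‖opTrace (stateBlock b ρ n j)‖ :=
      norm_pos_iff.2 ((h1.block j).opTrace_ne_zero h0)
    rw [norm_div, div_le_iff₀ hpos]
    have := (h1.elem_block j).norm_opTrace_mul_le x
    rwa [h1.opTrace_elem_block j] at this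

open Classical in
theorem weight_one (hb : IsWalk b) (hρ : IsBlockDensity ρ) (n : ℕ) (j : Λ) :
    weight b ρ n 1 j = if stateBlock b ρ n j = 0 then 0 else 1 := by
  obtain ⟨ι, u, h1, -⟩ := exists_hasDecomp_stateAt hb hρ n
  unfold weight
  split_ifs with h0
  · rfl
  · rw [mul_one]
    exact (congrArg (· / _) (h1.opTrace_elem_block j)).trans
      (div_self ((h1.block j).opTrace_ne_zero h0))

theorem transition_eq_kraus (hb : IsWalk b) (hρ : IsBlockDensity ρ) (n : ℕ)
    (x y : Op (Site H Λ)) :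
    transition b ρ n x y = kraus (fun ij : Λ × Λ => hop b ij.1 ij.2) (hasSum_norm_hop_sq hb)
      (norm_nonneg x) (fun ij => norm_weight_le hb hρ n x ij.2) y := by
  rw [transition_eq_strongSum]
  exact strongSum_eq (hasSum_kraus _ _ _ _ _)

theorem hasSum_transition (hb : IsWalk b) (hρ : IsBlockDensity ρ) (n : ℕ)
    (x y ξ : _) :
    HasSum (fun ij : Λ × Λ => weight b ρ n x ij.2 • star (hop b ij.1 ij.2)
      (y (hop b ij.1 ij.2 ξ))) (transition b ρ n x y ξ) := by
  rw [transition_eq_kraus hb hρ]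
  exact hasSum_kraus _ _ _ _ y ξ

theorem hasSum_inner_transition (hb : IsWalk b) (hρ : IsBlockDensity ρ) (n : ℕ)
    (x y : Op (Site H Λ)) (ξ : Site H Λ) :
    HasSum (fun ij : Λ × Λ => weight b ρ n x ij.2 *
      ⟪hop b ij.1 ij.2 ξ, y (hop b ij.1 ij.2 ξ)⟫_ℂ) ⟪ξ, transition b ρ n x y ξ⟫_ℂ := by
  have h := (hasSum_transition hb hρ n x y ξ).mapL (innerSL ℂ ξ)
  simpa only [innerSL_apply_apply, inner_smul_right, ContinuousLinearMap.star_eq_adjoint,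
    ContinuousLinearMap.adjoint_inner_right] using h

theorem norm_transition_one_le (hb : IsWalk b) (hρ : IsBlockDensity ρ) (n : ℕ)
    (y : Op (Site H Λ)) : ‖transition b ρ n 1 y‖ ≤ ‖y‖ := by
  rw [transition_eq_kraus hb hρ]
  refine (norm_kraus_le _ _ _ _ _).trans ?_
  exact mul_le_of_le_one_left (norm_nonneg y) ContinuousLinearMap.norm_id_le

theorem strongTendsto_transition (hb : IsWalk b) (hρ : IsBlockDensity ρ) (n : ℕ)
    (x : Op (Site H Λ)) {y : ℕ → Op (Site H Λ)} {y₀ : Op (Site H Λ)} {K : ℝ}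
    (hK : ∀ k, ‖y k‖ ≤ K) (hy : StrongTendsto y y₀) :
    StrongTendsto (fun k => transition b ρ n x (y k)) (transition b ρ n x y₀) := by
  simp only [transition_eq_kraus hb hρ]
  exact strongTendsto_kraus _ _ _ _ hK hy

theorem transition_sub (hb : IsWalk b) (hρ : IsBlockDensity ρ) (n : ℕ)
    (x y z : Op (Site H Λ)) :
    transition b ρ n x (y - z) = transition b ρ n x y - transition b ρ n x z := by
  ext1 ξ
  refine (hasSum_transition hb hρ n x (y - z) ξ).unique ?_
  convert! (hasSum_transition hb hρ n x y ξ).sub (hasSum_transition hb hρ n x z ξ) using 1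
  ext1 ij
  simp only [sub_apply, map_sub, smul_sub]

theorem transition_one_nonneg (hb : IsWalk b) (hρ : IsBlockDensity ρ) (n : ℕ)
    {y : Op (Site H Λ)} (hy : 0 ≤ y) : 0 ≤ transition b ρ n 1 y := by
  rw [ContinuousLinearMap.nonneg_iff_isPositive] at hy ⊢
  refine isPositive_of_inner_nonneg fun ξ =>
    (hasSum_inner_transition hb hρ n 1 y ξ).nonneg fun ij => ?_
  rw [weight_one hb hρ]
  refine mul_nonneg ?_ (hy.inner_nonneg_right _)
  split_ifs <;> simp

theorem transition_one_mono (hb : IsWalk b) (hρ : IsBlockDensity ρ) (n : ℕ)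
    {y z : Op (Site H Λ)} (hyz : y ≤ z) : transition b ρ n 1 y ≤ transition b ρ n 1 z := by
  rw [← sub_nonneg, ← transition_sub hb hρ]
  exact transition_one_nonneg hb hρ n (sub_nonneg.2 hyz)

theorem transition_one_one_le (hb : IsWalk b) (hρ : IsBlockDensity ρ) (n : ℕ) :
    transition b ρ n 1 1 ≤ 1 := by
  rw [ContinuousLinearMap.le_def]
  refine isPositive_of_inner_nonneg fun ξ => ?_
  have h1 := Complex.hasSum_ofReal.2 (hasSum_norm_hop_sq hb ξ)
  have h2 := h1.sub (hasSum_inner_transition hb hρ n 1 1 ξ)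
  have h3 : ((‖ξ‖ ^ 2 : ℝ) : ℂ) - ⟪ξ, transition b ρ n 1 1 ξ⟫_ℂ =
      ⟪ξ, (1 - transition b ρ n 1 1) ξ⟫_ℂ := by
    rw [sub_apply, inner_sub_right, one_apply_eq_self, inner_self_eq_norm_sq_to_K]
    norm_cast
  rw [h3] at h2
  refine h2.nonneg fun ij => ?_
  rw [weight_one hb hρ, one_apply_eq_self, inner_self_eq_norm_sq_to_K]
  split_ifs
  · rw [zero_mul, sub_zero]
    exact Complex.zero_le_real.2 (by positivity)
  · simp

theorem opTrace_stateAt_mul_transition (hb : IsWalk b) (hρ : IsBlockDensity ρ) (n : ℕ)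
    (y : Op (Site H Λ)) :
    opTrace (stateAt b ρ n * transition b ρ n 1 y) = opTrace (stateAt b ρ (n + 1) * y) := by
  obtain ⟨ι, u, h1, -⟩ := exists_hasDecomp_stateAt hb hρ n
  have h2 := (h1.step hb).hasSum_opTrace y
  rw [← stateAt_succ] at h2
  refine (h1.hasSum_opTrace _).unique
    (((Equiv.prodComm _ _).hasSum_iff.2 h2).prod_fiberwise fun l => ?_)
  convert! hasSum_inner_transition hb hρ n 1 y (u l) using 1
  ext1 ij
  rw [weight_one hb hρ]
  split_ifs with h0
  · have : u l ij.2 = 0 := (h1.block ij.2).eq_zero h0 l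
    simp [hop_apply, this]
  · simp

theorem norm_nested_one_le (hb : IsWalk b) (hρ : IsBlockDensity ρ) (l m : ℕ) :
    ‖nested (transition b ρ) (fun _ => 1) m l 1‖ ≤ 1 := by
  induction l generalizing m with
  | zero => exact ContinuousLinearMap.norm_id_le
  | succ l ih => exact (norm_transition_one_le hb hρ m _).trans (ih (m + 1))

theorem nested_one_nonneg (hb : IsWalk b) (hρ : IsBlockDensity ρ) (l m : ℕ) :
    0 ≤ nested (transition b ρ) (fun _ => 1) m l 1 := by
  induction l generalizing m with
  | zero => exact zero_le_one' (Op (Site H Λ))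
  | succ l ih => exact transition_one_nonneg hb hρ m (ih (m + 1))

theorem nested_one_succ_le (hb : IsWalk b) (hρ : IsBlockDensity ρ) (l m : ℕ) :
    nested (transition b ρ) (fun _ => 1) m (l + 1) 1 ≤
      nested (transition b ρ) (fun _ => 1) m l 1 := by
  induction l generalizing m with
  | zero => exact transition_one_one_le hb hρ m
  | succ l ih => exact transition_one_mono hb hρ m (ih (m + 1))

theorem opTrace_stateAt_mul_nested (hb : IsWalk b) (hρ : IsBlockDensity ρ) (l m : ℕ)
    (y : Op (Site H Λ)) :
    opTrace (stateAt b ρ m * nested (transition b ρ) (fun _ => 1) m l y) =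
      opTrace (stateAt b ρ (m + l) * y) := by
  induction l generalizing m with
  | zero => rfl
  | succ l ih =>
    rw [nested, opTrace_stateAt_mul_transition hb hρ, ih, Nat.add_right_comm, Nat.add_assoc]

theorem exists_strongTendsto_bSeq (hb : IsWalk b) (hρ : IsBlockDensity ρ) (n : ℕ) :
    ∃ T, StrongTendsto (bSeq (transition b ρ) n) T :=
  exists_strongTendsto_of_antitone (fun k => nested_one_nonneg hb hρ (k + 1) n)
    (antitone_nat_of_succ_le fun k => nested_one_succ_le hb hρ (k + 1) n)

theorem strongTendsto_bSeq (hb : IsWalk b) (hρ : IsBlockDensity ρ) (n : ℕ) :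
    StrongTendsto (bSeq (transition b ρ) n) (bBar (transition b ρ) n) := by
  obtain ⟨T, hT⟩ := exists_strongTendsto_bSeq hb hρ n
  rwa [bBar, hT.strongLim_eq]

theorem transition_one_bBar (hb : IsWalk b) (hρ : IsBlockDensity ρ) (n : ℕ) :
    transition b ρ n 1 (bBar (transition b ρ) (n + 1)) = bBar (transition b ρ) n :=
  (strongTendsto_transition hb hρ n 1 (fun k => norm_nested_one_le hb hρ (k + 1) (n + 1))
    (strongTendsto_bSeq hb hρ (n + 1))).unique ((strongTendsto_bSeq hb hρ n).shift 1)

theorem initialState_bBar (hb : IsWalk b) (hρ : IsBlockDensity ρ) :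
    initialState ρ (bBar (transition b ρ) 0) = 1 := by
  refine tendsto_nhds_unique (hρ.hasDecomp.1.tendsto_opTrace
    (fun k => norm_nested_one_le hb hρ (k + 1) 0) (strongTendsto_bSeq hb hρ 0)) ?_
  have h : ∀ k, opTrace (initial ρ * bSeq (transition b ρ) 0 k) = 1 := fun k => by
    have := opTrace_stateAt_mul_nested hb hρ (k + 1) 0 1
    rw [mul_one, opTrace_stateAt hb hρ] at this
    exact this
  exact tendsto_const_nhds.congr fun k => (h k).symm

theorem isMarkovPair (hb : IsWalk b) (hρ : IsBlockDensity ρ) :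
    IsMarkovPair (blockAlg H Λ) (initialState ρ) (transition b ρ) where
  bBar_exists := exists_strongTendsto_bSeq hb hρ
  consistent n a ha ξ := by
    refine tendsto_const_nhds.congr' (eventually_atTop.2 ⟨n, fun m hm => ?_⟩)
    obtain ⟨k, rfl⟩ := Nat.exists_eq_add_of_le hm
    exact congrArg (· ξ) (condExp_eq_of_eventually_one (transition_one_bBar hb hρ) ha k).symm
  markov := ⟨_, hasCondExp_one (transition_one_bBar hb hρ), initialState_bBar hb hρ⟩

end Transition

section VonNeumann

variable {G : Type u} [NormedAddCommGroup G] [InnerProductSpace ℂ G] [CompleteSpace G]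

theorem mem_vNGenerated_iff {S : Set (Op G)} {T : Op G} :
    T ∈ vNGenerated S ↔ ∀ g ∈ StarSubalgebra.centralizer ℂ S, g * T = T * g := by
  rw [vNGenerated, StarSubalgebra.mem_centralizer_iff]
  exact ⟨fun h g hg => (h g hg).1, fun h g hg => ⟨h g hg, h _ (star_mem hg)⟩⟩

theorem subset_vNGenerated {S : Set (Op G)} {T : Op G} (hT : T ∈ S) : T ∈ vNGenerated S :=
  mem_vNGenerated_iff.2 fun _ hg => ((StarSubalgebra.mem_centralizer_iff ℂ).1 hg T hT).1.symm

theorem StrongTendsto.mem_vNGenerated {S : Set (Op G)} {f : ℕ → Op G} {T : Op G}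
    (hT : StrongTendsto f T) (hf : ∀ n, f n ∈ vNGenerated S) : T ∈ vNGenerated S := by
  refine mem_vNGenerated_iff.2 fun g hg => ContinuousLinearMap.ext fun ξ => ?_
  have h1 := (g.continuous.tendsto _).comp (hT ξ)
  refine tendsto_nhds_unique h1 ((hT (g ξ)).congr fun n => ?_)
  exact (congrArg (· ξ) (mem_vNGenerated_iff.1 (hf n) g hg)).symm

theorem StrongTendsto.isStarProjection {f : ℕ → Op G} {T : Op G} (hT : StrongTendsto f T)
    (hf : ∀ n, IsStarProjection (f n)) : IsStarProjection T := by
  have h : star T * T = T := by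
    refine ContinuousLinearMap.ext fun ξ => ext_inner_left ℂ fun η => ?_
    rw [mul_apply_eq_comp, ContinuousLinearMap.star_eq_adjoint,
      ContinuousLinearMap.adjoint_inner_right]
    refine tendsto_nhds_unique ((hT η).inner (hT ξ))
      ((tendsto_const_nhds.inner (hT ξ)).congr fun n => ?_)
    rw [← ContinuousLinearMap.adjoint_inner_right, ← ContinuousLinearMap.star_eq_adjoint,
      (hf n).isSelfAdjoint.star_eq, ← mul_apply_eq_comp, (hf n).isIdempotentElem.eq]
  have hs : star T = T := by
    rw [← h, star_mul, star_star]
  exact ⟨by rw [IsIdempotentElem]; nth_rewrite 1 [← hs]; exact h, hs⟩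

omit [CompleteSpace G] in
/-- Cauchy–Schwarz for an operator-valued positive map, in the degenerate case. -/
theorem map_mul_eq_zero_of_map_star_mul_self {A : Type*} [Ring A] [StarRing A] [Algebra ℂ A]
    [StarModule ℂ A] {F : A →ₗ[ℂ] Op G} (hF : ∀ a, (F (star a * a)).IsPositive) {q : A}
    (hq : F (star q * q) = 0) (a : A) : F (star q * a) = 0 ∧ F (star a * q) = 0 := by
  have key : ∀ ξ, ⟪F (star a * q) ξ, ξ⟫_ℂ = 0 ∧ ⟪F (star q * a) ξ, ξ⟫_ℂ = 0 := by
    intro ξ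
    set α := ⟪F (star a * q) ξ, ξ⟫_ℂ
    set β := ⟪F (star q * a) ξ, ξ⟫_ℂ
    set κ := ⟪F (star a * a) ξ, ξ⟫_ℂ
    have h : ∀ c : ℂ, 0 ≤ κ + starRingEnd ℂ c * α + c * β := by
      intro c
      have h1 := (hF (a + c • q)).inner_nonneg_left ξ
      have h2 : star (a + c • q) * (a + c • q) = star a * a + c • (star a * q) +
          starRingEnd ℂ c • (star q * a) + (starRingEnd ℂ c * c) • (star q * q) := by
        simp only [star_add, star_smul, add_mul, mul_add, smul_mul_assoc, mul_smul_comm,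
          smul_add, starRingEnd_apply, mul_smul, smul_comm (star c) c]
        abel
      rw [h2] at h1
      simpa [hq, inner_add_left, inner_smul_left] using h1
    have lin : ∀ k s : ℝ, (∀ r : ℝ, 0 ≤ k + r * s) → s = 0 := by
      intro k s hs
      by_contra h0
      have := hs (-(k + 1) / s)
      rw [div_mul_cancel₀ _ h0] at this
      linarith
    have e1 : ∀ r : ℝ, 0 ≤ κ.re + r * (α.re + β.re) ∧ 0 = κ.im + r * (α.im + β.im) := by
      intro r
      have := Complex.nonneg_iff.1 (h r)
      simp only [Complex.conj_ofReal, Complex.add_re, Complex.add_im, Complex.re_ofReal_mul,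
        Complex.im_ofReal_mul] at this
      constructor <;> linarith [this.1, this.2]
    have e2 : ∀ r : ℝ, 0 ≤ κ.re + r * (α.im - β.im) ∧ 0 = κ.im + r * (β.re - α.re) := by
      intro r
      have := Complex.nonneg_iff.1 (h (r * Complex.I))
      simp only [map_mul, Complex.conj_ofReal, Complex.conj_I, Complex.add_re, Complex.add_im,
        mul_assoc, Complex.re_ofReal_mul, Complex.im_ofReal_mul, neg_mul, Complex.neg_re,
        Complex.neg_im, Complex.I_mul_re, Complex.I_mul_im] at this
      constructor <;> linarith [this.1, this.2]
    have h1 := lin _ _ fun r => (e1 r).1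
    have h2 := lin _ _ fun r => (e2 r).1
    have h3 := (e1 0).2
    have h4 := (e1 1).2
    have h5 := (e2 1).2
    constructor <;> apply Complex.ext <;> simp only [Complex.zero_re, Complex.zero_im] <;> linarith
  constructor
  · have := (inner_map_self_eq_zero (F (star q * a) : G →ₗ[ℂ] G)).1 fun ξ => (key ξ).2
    exact ContinuousLinearMap.coe_injective this
  · have := (inner_map_self_eq_zero (F (star a * q) : G →ₗ[ℂ] G)).1 fun ξ => (key ξ).1
    exact ContinuousLinearMap.coe_injective this

omit [CompleteSpace G] in
theorem map_conj_eq_of_map_eq_map_one {A : Type*} [Ring A] [StarRing A] [Algebra ℂ A]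
    [StarModule ℂ A] {F : A →ₗ[ℂ] Op G} (hF : ∀ a, (F (star a * a)).IsPositive) {p : A}
    (hp : IsStarProjection p) (hFp : F p = F 1) (a : A) : F (p * a * p) = F a := by
  have hq : F (star (1 - p) * (1 - p)) = 0 := by
    rw [hp.one_sub.isSelfAdjoint.star_eq, hp.one_sub.isIdempotentElem.eq, map_sub, hFp, sub_self]
  have h1 := (map_mul_eq_zero_of_map_star_mul_self hF hq a).1
  have h2 := (map_mul_eq_zero_of_map_star_mul_self hF hq (star (p * a))).2
  rw [hp.one_sub.isSelfAdjoint.star_eq, sub_mul, one_mul, map_sub, sub_eq_zero] at h1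
  rw [star_star, mul_sub, mul_one, map_sub, sub_eq_zero] at h2
  rw [← h2, h1]

end VonNeumann

section Reducing

variable {G : Type u} [NormedAddCommGroup G] [InnerProductSpace ℂ G] [CompleteSpace G]
  {B : StarSubalgebra ℂ (Op G)}

omit [CompleteSpace G] in
theorem nested_congr {E : ℕ → Op G → Op G → Op G} {a a' : ℕ → Op G}
    (h : ∀ n y, E n (a n) y = E n (a' n) y) (l m : ℕ) (y : Op G) :
    nested E a m l y = nested E a' m l y := by
  induction l generalizing m with
  | zero => rfl
  | succ l ih => simp only [nested, ih, h]

theorem tailSeq_one_zero (p : B) : tailSeq p 1 0 = 1 := if_pos one_pos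

theorem tailSeq_one_succ (p : B) (n : ℕ) : tailSeq p 1 (n + 1) = p := if_neg (by omega)

theorem condExp_tailSeq_conj {E : ℕ → Op G → Op G → Op G} {p : B}
    (hE : ∀ n (x y : Op G), E (n + 1) (p * x * p) y = E (n + 1) x y) (n : ℕ) (s : ℕ → B) :
    condExp E n (tailSeq p 1 * s * tailSeq p 1) = condExp E n s := by
  refine nested_congr (fun k y => ?_) _ _ _
  cases k with
  | zero => simp [tailSeq_one_zero]
  | succ k => simp [tailSeq_one_succ, hE]

theorem sum_condExp_tailProj_conj {E : ℕ → Op G → Op G → Op G} {p : B}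
    (hE : ∀ n (x y : Op G), E (n + 1) (p * x * p) y = E (n + 1) x y) (n : ℕ)
    (a : ProductAlgebra B) :
    ((tailProj p 1 * a * tailProj p 1).coeff.sum fun s c => c • condExp E n s) =
      a.coeff.sum fun s c => c • condExp E n s := by
  have hadd : ∀ x y : ProductAlgebra B, ((x + y).coeff.sum fun s c => c • condExp E n s) =
      (x.coeff.sum fun s c => c • condExp E n s) + y.coeff.sum fun s c => c • condExp E n s :=
    fun x y => Finsupp.sum_add_index' (fun _ => zero_smul _ _) fun _ _ _ => add_smul _ _ _
  induction a using MonoidAlgebra.induction_linear with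
  | zero => simp
  | add x y hx hy => rw [mul_add, add_mul, hadd, hadd, hx, hy]
  | single s c =>
    simp only [tailProj, MonoidAlgebra.of_apply, MonoidAlgebra.single_mul_single, one_mul, mul_one,
      MonoidAlgebra.coeff_single]
    rw [Finsupp.sum_single_index (by exact zero_smul _ _),
      Finsupp.sum_single_index (by exact zero_smul _ _), condExp_tailSeq_conj hE]

namespace Copies

variable {K : Type w} [NormedAddCommGroup K] [InnerProductSpace ℂ K] [CompleteSpace K]
  (R : Copies B K)

theorem prodUpTo_succ (n : ℕ) (a : ℕ → B) :
    R.prodUpTo (n + 1) a = R.prodUpTo n a * R.J (n + 1) (a (n + 1)) := by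
  rw [prodUpTo, List.range_succ, List.map_append, List.prod_append, List.map_singleton,
    List.prod_singleton, prodUpTo]

theorem prodUpTo_zero (a : ℕ → B) : R.prodUpTo 0 a = R.J 0 (a 0) := by
  simp [prodUpTo]

theorem commute_prodUpTo (a : ℕ → B) (x : B) {n m : ℕ} (h : n < m) :
    Commute (R.prodUpTo n a) (R.J m x) := by
  induction n with
  | zero => rw [prodUpTo_zero]; exact R.commute _ _ h.ne _ _
  | succ n ih =>
    rw [prodUpTo_succ]
    exact (ih (by omega)).mul_left (R.commute _ _ h.ne _ _)

theorem isStarProjection_prodUpTo {a : ℕ → B} (ha : ∀ n, IsStarProjection (a n)) (n : ℕ) :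
    IsStarProjection (R.prodUpTo n a) := by
  induction n with
  | zero => rw [prodUpTo_zero]; exact (ha 0).map (R.J 0)
  | succ n ih =>
    rw [prodUpTo_succ]
    exact ih.mul ((ha _).map (R.J (n + 1))) (R.commute_prodUpTo a _ n.lt_succ_self)

theorem prodUpTo_mem_algebra (a : ℕ → B) (n : ℕ) : R.prodUpTo n a ∈ R.algebra := by
  have h : ∀ k x, R.J k x ∈ R.algebra := fun k x =>
    subset_vNGenerated (Set.mem_iUnion.2 ⟨k, Set.mem_range_self x⟩)
  induction n with
  | zero => rw [prodUpTo_zero]; exact h _ _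
  | succ n ih => rw [prodUpTo_succ]; exact mul_mem ih (h _ _)

theorem prodUpTo_one (n : ℕ) : R.prodUpTo n 1 = 1 := by
  induction n with
  | zero => rw [prodUpTo_zero]; exact map_one _
  | succ n ih => rw [prodUpTo_succ, ih]; exact (one_mul _).trans (map_one _)

theorem antitone_prodUpTo {a : ℕ → B} (ha : ∀ n, IsStarProjection (a n)) :
    Antitone fun n => R.prodUpTo n a := by
  refine antitone_nat_of_succ_le fun n => ?_
  refine (R.isStarProjection_prodUpTo ha (n + 1)).le_of_mul_eq_right
    (R.isStarProjection_prodUpTo ha n) ?_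
  rw [prodUpTo_succ, ← mul_assoc, (R.isStarProjection_prodUpTo ha n).isIdempotentElem.eq]

theorem exists_isInfProd {a : ℕ → B} (ha : ∀ n, IsStarProjection (a n)) :
    ∃ P : R.algebra, IsStarProjection P ∧ R.IsInfProd a (P : Op K) := by
  obtain ⟨P, hP⟩ := exists_strongTendsto_of_antitone
    (fun n => (R.isStarProjection_prodUpTo ha n).nonneg) (R.antitone_prodUpTo ha)
  have h := hP.isStarProjection (R.isStarProjection_prodUpTo ha)
  exact ⟨⟨P, hP.mem_vNGenerated (R.prodUpTo_mem_algebra a)⟩,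
    ⟨Subtype.ext h.isIdempotentElem, Subtype.ext h.isSelfAdjoint⟩, hP⟩

end Copies

theorem isReducing_one {E : ℕ → Op G → Op G → Op G} {p : B} (hp : IsStarProjection p)
    (hp0 : p ≠ 0) (hp1 : p ≠ 1)
    (hE : ∀ n (x y : Op G), E (n + 1) (p * x * p) y = E (n + 1) x y) :
    IsReducing.{u, w} E p 1 where
  proj := hp
  ne_zero := hp0
  ne_one := hp1
  products a x := by
    unfold HasCondExp
    simp only [sum_condExp_tailProj_conj hE]
  vonNeumann K _ _ _ R F hF := by
    have ht : ∀ n, IsStarProjection (tailSeq p 1 n) := by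
      rintro (_ | n)
      · rw [tailSeq_one_zero]; exact .one _
      · rwa [tailSeq_one_succ]
    have htt : tailSeq p 1 * 1 * tailSeq p 1 = tailSeq p 1 := by
      rw [mul_one]
      exact funext fun n => (ht n).isIdempotentElem
    obtain ⟨P, hP, hPprod⟩ := R.exists_isInfProd ht
    refine ⟨P, hPprod, map_conj_eq_of_map_eq_map_one hF.pos hP ?_⟩
    have h1 : StrongTendsto (fun n => condExp E n (1 : ℕ → B)) (F 1) :=
      hF.prod 1 1 fun ξ => tendsto_const_nhds.congr fun n =>
        congrArg (· ξ) (R.prodUpTo_one n).symm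
    have h2 := hF.prod _ P hPprod
    rw [← htt] at h2
    simp only [condExp_tailSeq_conj hE] at h2
    exact h2.unique h1

end Reducing

section Walk

variable {H : Type u} [NormedAddCommGroup H] [InnerProductSpace ℂ H] [CompleteSpace H]
  {Λ : Type v} {b : Λ → Λ → Op H} {ρ : Λ → Op H}

variable (Λ) in
/-- The operator `h ⊗ I` on `ℋ ⊗ 𝒦`. -/
def ampl (h : Op H) : Op (Site H Λ) :=
  lp.mapCLM 2 (fun _ : Λ => h) (norm_nonneg h) fun _ => le_rfl

omit [CompleteSpace H] in
theorem ampl_apply (h : Op H) (ξ : Site H Λ) (i : Λ) : ampl Λ h ξ i = h (ξ i) := rfl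

omit [CompleteSpace H] in
theorem ampl_ket (h : Op H) (j : Λ) (η : H) :
    ampl Λ h (ket H j η) = (ket H j (h η) : Site H Λ) := by
  classical
  ext i
  rw [ampl_apply]
  rcases eq_or_ne i j with rfl | hij
  · rw [ket_apply_self, ket_apply_self]
  · have h0 : ∀ η : H, (ket H j η : Site H Λ) i = 0 := fun η => lp.single_apply_ne _ _ _ hij
    rw [h0, h0, map_zero]

theorem elem_mem_blockAlg₀ (a : Op H) (i : Λ) : elem a i i ∈ blockAlg₀ H Λ := by
  classical
  refine ⟨Pi.single i a, summable_of_ne_finset_zero (s := {i}) fun j hj => ?_, ?_⟩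
  · simp [Pi.single_eq_of_ne (Finset.notMem_singleton.1 hj)]
  · rw [tsum_eq_single i fun j hj => by simp [elem, Pi.single_eq_of_ne hj], Pi.single_eq_same]

theorem hasSum_elem_ampl (h : Op H) (ξ : Site H Λ) :
    HasSum (fun i => elem h i i ξ) (ampl Λ h ξ) := by
  classical
  simp only [elem_apply]
  exact lp.hasSum_single (by norm_num) (ampl Λ h ξ)

theorem ampl_mem_blockAlg (h : Op H) : ampl Λ h ∈ blockAlg H Λ := by
  refine mem_vNGenerated_iff.2 fun g hg => ContinuousLinearMap.ext fun ξ => ?_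
  refine ((hasSum_elem_ampl h ξ).mapL g).unique ?_
  convert! hasSum_elem_ampl h (g ξ) using 1
  ext1 i
  exact (congrArg (· ξ)
    ((StarSubalgebra.mem_centralizer_iff ℂ).1 hg _ (elem_mem_blockAlg₀ h i)).1).symm

theorem isStarProjection_ampl {h : Op H} (hh : IsStarProjection h) :
    IsStarProjection (ampl Λ h) where
  isIdempotentElem := ContinuousLinearMap.ext fun ξ => by
    ext i
    exact congrArg (· (ξ i)) hh.isIdempotentElem.eq
  isSelfAdjoint := by
    refine ContinuousLinearMap.ext fun ξ => ext_inner_right ℂ fun η => ?_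
    rw [ContinuousLinearMap.star_eq_adjoint, ContinuousLinearMap.adjoint_inner_left,
      lp.inner_eq_tsum, lp.inner_eq_tsum]
    refine tsum_congr fun i => ?_
    rw [ampl_apply, ampl_apply, ← ContinuousLinearMap.adjoint_inner_left,
      ← ContinuousLinearMap.star_eq_adjoint, hh.isSelfAdjoint.star_eq]

omit [CompleteSpace H] in
theorem ampl_injective [Nonempty Λ] : Function.Injective (ampl Λ : Op H → Op (Site H Λ)) := by
  intro a a' h
  obtain ⟨i⟩ := ‹Nonempty Λ›
  ext η
  have := congrArg (fun T : Op (Site H Λ) => T (ket H i η) i) h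
  simpa only [ampl_apply, ket_apply_self] using this

theorem IsBlockDensity.nonempty (hρ : IsBlockDensity ρ) : Nonempty Λ := by
  by_contra hΛ
  rw [not_nonempty_iff] at hΛ
  exact zero_ne_one (hasSum_empty.unique hρ.total)

theorem ampl_hop {h : Op H} (hh : ∀ i j, h * b i j = b i j) (i j : Λ) (ξ : Site H Λ) :
    ampl Λ h (hop b i j ξ) = hop b i j ξ := by
  rw [hop_apply, ampl_ket, ← mul_apply_eq_comp, hh]

theorem weight_succ_conj (hb : IsWalk b) (hρ : IsBlockDensity ρ) {h : Op H}
    (hproj : IsStarProjection h) (hh : ∀ i j, h * b i j = b i j) (n : ℕ) (x : Op (Site H Λ)) (j : Λ) :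
    weight b ρ (n + 1) (ampl Λ h * x * ampl Λ h) j = weight b ρ (n + 1) x j := by
  obtain ⟨ι, u, h1, -⟩ := exists_hasDecomp_stateAt hb hρ n
  have h2 := (h1.step hb).elem_block j
  rw [← stateAt_succ] at h2
  have h3 : opTrace (elem (stateBlock b ρ (n + 1) j) j j * (ampl Λ h * x * ampl Λ h)) =
      opTrace (elem (stateBlock b ρ (n + 1) j) j j * x) := by
    refine (h2.hasSum_opTrace _).unique ?_
    convert! h2.hasSum_opTrace x using 1
    ext1 l
    have h4 : ampl Λ h (ket H j (hop b l.1.1 l.1.2 (u l.2) j)) =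
        ket H j (hop b l.1.1 l.1.2 (u l.2) j) := by
      rw [ampl_ket, ← ampl_apply, ampl_hop hh]
    rw [mul_apply_eq_comp, mul_apply_eq_comp, h4, ← ContinuousLinearMap.adjoint_inner_left,
      ← ContinuousLinearMap.star_eq_adjoint, (isStarProjection_ampl hproj).isSelfAdjoint.star_eq,
      h4]
  simp only [weight, h3]

end Walk

end OQRW

end

theorem theorem4p9 {H : Type u} [NormedAddCommGroup H] [InnerProductSpace ℂ H]
    [CompleteSpace H] [TopologicalSpace.SeparableSpace H] {Λ : Type v} [Countable Λ]
    (b : Λ → Λ → OQRW.Op H) (hb : OQRW.IsWalk b)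
    (ρ : Λ → OQRW.Op H) (hρ : OQRW.IsBlockDensity ρ)
    (h : OQRW.Op H) (hproj : IsStarProjection h) (hne_zero : h ≠ 0) (hne_one : h ≠ 1)
    (hpath : ∀ (i j : Λ) (π : OQRW.SitePath Λ i j), h * OQRW.pathOp b π = OQRW.pathOp b π) :
    OQRW.IsMarkovPair (OQRW.blockAlg H Λ) (OQRW.initialState ρ) (OQRW.transition b ρ) ∧
    OQRW.IsReducible.{max u v, w} (OQRW.blockAlg H Λ) (OQRW.transition b ρ) ∧
    ∃ p : OQRW.blockAlg H Λ,
      (∀ (ξ : OQRW.Site H Λ) (i : Λ), (p : OQRW.Op (OQRW.Site H Λ)) ξ i = h (ξ i)) ∧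
      OQRW.IsReducing.{max u v, w} (OQRW.transition b ρ) p 1 := by
  have hh : ∀ i j, h * b i j = b i j := fun i j => hpath j i (.single j i)
  have hΛ := hρ.nonempty
  have hP := OQRW.isStarProjection_ampl (Λ := Λ) hproj
  have hred : OQRW.IsReducing.{max u v, w} (OQRW.transition b ρ)
      (⟨OQRW.ampl Λ h, OQRW.ampl_mem_blockAlg h⟩ : OQRW.blockAlg H Λ) 1 := by
    refine OQRW.isReducing_one ⟨Subtype.ext hP.isIdempotentElem, Subtype.ext hP.isSelfAdjoint⟩
      (fun h0 => hne_zero (OQRW.ampl_injective (Λ := Λ) ?_))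
      (fun h1 => hne_one (OQRW.ampl_injective (Λ := Λ) ?_)) fun n x y => ?_
    · exact congrArg Subtype.val h0
    · exact congrArg Subtype.val h1
    · simp only [OQRW.transition_eq_strongSum, OQRW.weight_succ_conj hb hρ hproj hh]
  exact ⟨OQRW.isMarkovPair hb hρ, ⟨_, _, hred⟩, _, fun _ _ => rfl, hred⟩
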